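/- Let $A$ be a unital $C^*$-algebra and let $\alpha\colon A\to A$ be a $*$-endomorphism (not necessarily preserving the unit). A \emph{faithful representation} of $(A,\alpha)$ is a triple $(\pi,U,H)$ consisting of a Hilbert space $H$, an injective unital $*$-homomorphism $\pi\colon A\to L(H)$ and an operator $U\in L(H)$ such that $U\pi(a)U^*=\pi(\alpha(a))$ for all $a\in A$. For a closed two-sided ideal $J$ of $A$, it is called \emph{$J$-covariant} if $J=\{a\in A: U^*U\pi(a)=\pi(a)\}$. It has \emph{property $(*)$} if $$\Big\|\sum_{m} U^{*m}\pi(a_{m,m})U^m\Big\|\le\Big\|\sum_{m,n} U^{*m}\pi(a_{m,n})U^n\Big\|$$ for every matrix $(a_{m,n})_{m,n\in\mathbb N}$ (where $0\in\mathbb N$) with only finitely many nonzero entries and with $a_{m,n}\in\alpha^m(1)A\alpha^n(1)$ for all $m,n$. Denote by $C^*(\pi(A),U)\subseteq L(H)$ the $C^*$-algebra generated by $\pi(A)$ and $U$. \textbf{Theorem (Isomorphism Theorem).} Let $J$ be a closed two-sided ideal of $A$ with $J\cap\ker\alpha=\{0\}$, and let $(\pi_i,U_i,H_i)$, $i=1,2$,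 be faithful $J$-covariant representations of $(A,\alpha)$ possessing property $(*)$. Then there is a unique $*$-isomorphism $\Phi\colon C^*(\pi_1(A),U_1)\to C^*(\pi_2(A),U_2)$ such that $\Phi(\pi_1(a))=\pi_2(a)$ for all $a\in A$ and $\Phi(U_1)=U_2$. -/

import Mathlib

/-- A representation `(π, U, H)` of a `C*`-dynamical system `(A, α)`: a unital
`*`-representation `π` of `A` on the Hilbert space `H` together with an operator `U` on `H` such
that `U π(a) U* = π(α(a))` for all `a`. The endomorphism `α` need not preserve the unit. -/
structure DynRep {A : Type*} [CStarAlgebra A] (α : A →⋆ₙₐ[ℂ] A)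
    (H : Type*) [NormedAddCommGroup H] [InnerProductSpace ℂ H] [CompleteSpace H] where
  π : A →⋆ₐ[ℂ] (H →L[ℂ] H)
  U : H →L[ℂ] H
  covariance : ∀ a : A, U * π a * star U = π (α a)

namespace DynRep

/-- Membership in `M(A)`: finitely supported matrices `a`, indexed by pairs of natural numbers,
such that `a (i, j)` lies in `αⁱ(1) A αʲ(1)`. -/
def IsAdmissible {A : Type*} [CStarAlgebra A] (α : A →⋆ₙₐ[ℂ] A) (a : ℕ × ℕ →₀ A) : Prop :=
  ∀ i j : ℕ, ∃ b : A, a (i, j) = α^[i] 1 * b * α^[j] 1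

variable {A : Type*} [CStarAlgebra A] {α : A →⋆ₙₐ[ℂ] A}
  {H : Type*} [NormedAddCommGroup H] [InnerProductSpace ℂ H] [CompleteSpace H]

/-- The representation is faithful when `π` is injective. -/
def IsFaithful (R : DynRep α H) : Prop := Function.Injective R.π

/-- The representation is `J`-covariant when `J = {a ∈ A : U* U π(a) = π(a)}`. -/
def IsCovariantFor (R : DynRep α H) (J : TwoSidedIdeal A) : Prop :=
  (J : Set A) = {a : A | star R.U * R.U * R.π a = R.π a}

/-- The operator `∑_{m,n} U*ᵐ π(a_{m,n}) Uⁿ` given by a finitely supported matrix `a`. -/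
noncomputable def ofMatrix (R : DynRep α H) (a : ℕ × ℕ →₀ A) : H →L[ℂ] H :=
  a.sum fun p x => star R.U ^ p.1 * R.π x * R.U ^ p.2

/-- Property `(*)`: for every matrix `a` in `M(A)`,
`‖∑_m U*ᵐ π(a_{m,m}) Uᵐ‖ ≤ ‖∑_{m,n} U*ᵐ π(a_{m,n}) Uⁿ‖`. -/
def PropertyStar (R : DynRep α H) : Prop :=
  ∀ a : ℕ × ℕ →₀ A, IsAdmissible α a →
    ‖R.ofMatrix (a.filter fun p => p.1 = p.2)‖ ≤ ‖R.ofMatrix a‖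

/-- `C*(π(A), U)`: the norm closure of the `*`-algebra generated by `π(A)` and `U`. It contains
the identity operator anyway, since `π(1) = 1`. -/
noncomputable def cstar (R : DynRep α H) : StarSubalgebra ℂ (H →L[ℂ] H) :=
  (StarAlgebra.adjoin ℂ (Set.range R.π ∪ {R.U})).topologicalClosure

/-- `π(a)` as an element of `C*(π(A), U)`. -/
noncomputable def gen (R : DynRep α H) (a : A) : R.cstar :=
  ⟨R.π a, StarSubalgebra.le_topologicalClosure _
    (StarAlgebra.subset_adjoin ℂ _ (Or.inl ⟨a, rfl⟩))⟩

/-- `U` as an element of `C*(π(A), U)`. -/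
noncomputable def genU (R : DynRep α H) : R.cstar :=
  ⟨R.U, StarSubalgebra.le_topologicalClosure _
    (StarAlgebra.subset_adjoin ℂ _ (Or.inr rfl))⟩

end DynRep

/-! Put both representations into `L(H₁) × L(H₂)`: the pair `(π₁ ⊕ π₂, (U₁, U₂))` is again
covariant. If `‖z.1‖ = ‖z.2‖` on the `*`-algebra it generates, both coordinate projections are
isometric there, so the closure maps isomorphically onto each `C*(πᵢ(A), Uᵢ)`, and `Φ` is one map
after the inverse of the other.

Covariance makes this algebra the span of words `U*ᵐ π(a) Uⁿ`, of degree `n - m`. A degree-zero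
element has the form `π(a) + U* y U` with `y` a shorter element of the same kind. As `U*U` is a
projection commuting with `π(A)`, the norm is the maximum of `‖π(a)(1 - U*U)‖` and the norm of a
shorter element (`norm_nested`). The first depends only on the kernel of `a ↦ π(a)(1 - U*U)`, which
is `J` in both representations; induction handles the second.

For `x = ∑ x_d` with `|d| ≤ N`, Cauchy-Schwarz gives `‖x‖² ≤ (2N + 1) ‖∑ x_d x_d*‖`. The last sum is
the degree-zero part of `x x*`, so its norm may be computed in the other representation, where
property `(*)` bounds it by `‖x‖²`. Applying this to the powers `(x x*)^(2^k)` removes the factor,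
which grows only linearly in `2^k` (`norm_le_of_mem_boundedSpan`). -/

/-! ### Commutation relations of a covariant pair -/

section CovariantPair

variable {A B : Type*} [CStarAlgebra A] [CStarAlgebra B] {α : A →⋆ₙₐ[ℂ] A}
  {π : A →⋆ₐ[ℂ] B} {U : B}

/-- A covariant pair `(π, U)` for `(A, α)` in an abstract `C*`-algebra. -/
def IsCovariantPair (α : A →⋆ₙₐ[ℂ] A) (π : A →⋆ₐ[ℂ] B) (U : B) : Prop :=
  ∀ a : A, U * π a * star U = π (α a)

namespace IsCovariantPair

lemma mul_star (h : IsCovariantPair α π U) : U * star U = π (α 1) := by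
  simpa using h 1

/-- With `D = U π(a) - π(α a) U`, all four terms of `D D*` equal `π(α(a a*))`, so `D D* = 0`. -/
lemma mul_map (h : IsCovariantPair α π U) (a : A) : U * π a = π (α a) * U := by
  rw [← sub_eq_zero, ← CStarRing.mul_star_self_eq_zero_iff]
  have h1 : U * π a * star (U * π a) = π (α (a * star a)) := by
    rw [← h, star_mul, map_mul, map_star]; noncomm_ring
  have h2 : U * π a * star (π (α a) * U) = π (α (a * star a)) := by
    rw [star_mul, ← mul_assoc, h, ← map_star, ← map_star, ← map_mul, ← map_mul]
  have h3 : π (α a) * U * star (U * π a) = π (α (a * star a)) := by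
    rw [star_mul, ← map_star, mul_assoc, ← mul_assoc U, h, ← map_mul, ← map_mul]
  have h4 : π (α a) * U * star (π (α a) * U) = π (α (a * star a)) := by
    rw [star_mul, mul_assoc, ← mul_assoc U, h.mul_star, ← map_star, ← map_star, ← map_mul,
      ← map_mul, ← map_mul, ← map_mul, one_mul]
  rw [star_sub, mul_sub, sub_mul, sub_mul, h1, h2, h3, h4]
  simp

lemma map_mul_star (h : IsCovariantPair α π U) (a : A) : π a * star U = star U * π (α a) := by
  have := congrArg star (h.mul_map (star a))
  simpa [star_mul, map_star] using this

lemma pow_mul_map (h : IsCovariantPair α π U) (n : ℕ) (a : A) :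
    U ^ n * π a = π (α^[n] a) * U ^ n := by
  induction n generalizing a with
  | zero => simp
  | succ n ih =>
    rw [pow_succ, mul_assoc, h.mul_map, ← mul_assoc, ih, Function.iterate_succ_apply, mul_assoc]

lemma map_mul_star_pow (h : IsCovariantPair α π U) (n : ℕ) (a : A) :
    π a * star U ^ n = star U ^ n * π (α^[n] a) := by
  induction n generalizing a with
  | zero => simp
  | succ n ih =>
    rw [pow_succ', ← mul_assoc, h.map_mul_star, mul_assoc, ih, Function.iterate_succ_apply,
      mul_assoc]

lemma pow_mul_star_pow (h : IsCovariantPair α π U) (n : ℕ) :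
    U ^ n * star U ^ n = π (α^[n] 1) := by
  induction n with
  | zero => simp
  | succ n ih =>
    rw [pow_succ', pow_succ, mul_assoc, ← mul_assoc (U ^ n), ih, ← mul_assoc, h,
      Function.iterate_succ_apply']

lemma map_iterate_one_mul_pow (h : IsCovariantPair α π U) (n : ℕ) :
    π (α^[n] 1) * U ^ n = U ^ n := by
  simpa using (h.pow_mul_map n 1).symm

lemma star_pow_mul_map_iterate_one (h : IsCovariantPair α π U) (n : ℕ) :
    star U ^ n * π (α^[n] 1) = star U ^ n := by
  simpa using (h.map_mul_star_pow n 1).symm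

lemma map_one_mul (h : IsCovariantPair α π U) : π (α 1) * U = U := by
  simpa using h.map_iterate_one_mul_pow 1

lemma star_mul_map_one (h : IsCovariantPair α π U) : star U * π (α 1) = star U := by
  simpa using h.star_pow_mul_map_iterate_one 1

lemma isStarProjection_star_mul (h : IsCovariantPair α π U) :
    IsStarProjection (star U * U) where
  isIdempotentElem := by
    rw [IsIdempotentElem, mul_assoc, ← mul_assoc U, h.mul_star, h.map_one_mul]
  isSelfAdjoint := .star_mul_self U

lemma map_commute_star_mul (h : IsCovariantPair α π U) (a : A) :
    Commute (π a) (star U * U) := by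
  rw [Commute, SemiconjBy, ← mul_assoc, h.map_mul_star, mul_assoc, ← h.mul_map, mul_assoc]

end IsCovariantPair

/-! ### Words graded by degree -/

/-- The span of the words `U*ᵐ π(a) Uⁿ` of degree `n - m = d`. -/
noncomputable def degreeSpan (π : A →⋆ₐ[ℂ] B) (U : B) (d : ℤ) : Submodule ℂ B :=
  Submodule.span ℂ {x | ∃ (m n : ℕ) (a : A), (n : ℤ) - m = d ∧ x = star U ^ m * π a * U ^ n}

lemma word_mem_degreeSpan (m n : ℕ) (a : A) {d : ℤ} (hd : (n : ℤ) - m = d) :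
    star U ^ m * π a * U ^ n ∈ degreeSpan π U d :=
  Submodule.subset_span ⟨m, n, a, hd, rfl⟩

lemma map_mem_degreeSpan_zero (a : A) : π a ∈ degreeSpan π U 0 := by
  simpa using word_mem_degreeSpan (π := π) (U := U) 0 0 a (d := 0) (by simp)

lemma mem_degreeSpan_one : U ∈ degreeSpan π U 1 := by
  simpa using word_mem_degreeSpan (π := π) (U := U) 0 1 1 (d := 1) (by simp)

lemma star_mem_degreeSpan {x : B} {d : ℤ} (hx : x ∈ degreeSpan π U d) :
    star x ∈ degreeSpan π U (-d) := by
  induction hx using Submodule.span_induction with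
  | mem x hx =>
    obtain ⟨m, n, a, hd, rfl⟩ := hx
    have := word_mem_degreeSpan (π := π) (U := U) n m (star a) (d := -d) (by omega)
    simpa [star_mul, mul_assoc, map_star] using this
  | zero => simp
  | add x y _ _ hx hy => simpa using add_mem hx hy
  | smul c x _ hx => simpa using Submodule.smul_mem _ _ hx

namespace IsCovariantPair

/-- In the middle factor `Uʲ U*ᵏ` the common power collapses to a value of `π`; the surplus power of
`U` or `U*` then moves outward past `π` by applying `α`. -/
lemma word_mul_word (h : IsCovariantPair α π U) (i j k l : ℕ) (a b : A) :
    star U ^ i * π a * U ^ j * (star U ^ k * π b * U ^ l) ∈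
      degreeSpan π U (((j : ℤ) - i) + (l - k)) := by
  rcases le_total k j with hkj | hjk
  · obtain ⟨t, rfl⟩ := Nat.exists_eq_add_of_le' hkj
    convert word_mem_degreeSpan (π := π) (U := U) i (t + l) (a * α^[t] (α^[k] 1 * b)) ?_ using 1
    · calc _ = star U ^ i * π a * (U ^ t * (U ^ k * star U ^ k * π b) * U ^ l) := by
            rw [pow_add]; simp only [mul_assoc]
        _ = _ := by
            rw [h.pow_mul_star_pow, ← map_mul, h.pow_mul_map, map_mul, pow_add]
            simp only [mul_assoc]
    · push_cast; ring
  · obtain ⟨t, rfl⟩ := Nat.exists_eq_add_of_le hjk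
    convert word_mem_degreeSpan (π := π) (U := U) (i + t) l (α^[t] (a * α^[j] 1) * b) ?_ using 1
    · calc _ = star U ^ i * (π a * (U ^ j * star U ^ j) * star U ^ t * π b) * U ^ l := by
            rw [pow_add]; simp only [mul_assoc]
        _ = _ := by
            rw [h.pow_mul_star_pow, ← map_mul, h.map_mul_star_pow, map_mul, pow_add]
            simp only [mul_assoc]
    · push_cast; ring

lemma mul_mem_degreeSpan (h : IsCovariantPair α π U) {x y : B} {d e : ℤ}
    (hx : x ∈ degreeSpan π U d) (hy : y ∈ degreeSpan π U e) :
    x * y ∈ degreeSpan π U (d + e) := by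
  refine (Submodule.mul_le (P := degreeSpan π U (d + e))).1 ?_ x hx y hy
  rw [degreeSpan, degreeSpan, Submodule.span_mul_span, Submodule.span_le]
  rintro _ ⟨_, ⟨i, j, a, rfl, rfl⟩, _, ⟨k, l, b, rfl, rfl⟩, rfl⟩
  exact h.word_mul_word i j k l a b

end IsCovariantPair

/-- The sums of words `U*ᵐ π(a) Uⁿ` with `|n - m| ≤ N`. -/
def boundedSpan (π : A →⋆ₐ[ℂ] B) (U : B) (N : ℕ) : Set B :=
  {x | ∃ f : ℤ → B, (∀ d, f d ∈ degreeSpan π U d) ∧ x = ∑ d ∈ Finset.Icc (-(N : ℤ)) N, f d}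

lemma mem_boundedSpan_of_sum {ι : Type*} (s : Finset ι) (deg : ι → ℤ) (g : ι → B) {N : ℕ}
    (hdeg : ∀ i ∈ s, |deg i| ≤ N) (hg : ∀ i ∈ s, g i ∈ degreeSpan π U (deg i)) :
    ∑ i ∈ s, g i ∈ boundedSpan π U N := by
  refine ⟨fun d => ∑ i ∈ s with deg i = d, g i, fun d => ?_, ?_⟩
  · refine Submodule.sum_mem _ fun i hi => ?_
    obtain ⟨hi, hd⟩ := Finset.mem_filter.1 hi
    exact hd ▸ hg i hi
  · exact (Finset.sum_fiberwise_of_maps_to (fun i hi => Finset.mem_Icc.2 (abs_le.1 (hdeg i hi)))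
      g).symm

lemma mem_boundedSpan {x : B} {d : ℤ} {N : ℕ} (hd : |d| ≤ N) (hx : x ∈ degreeSpan π U d) :
    x ∈ boundedSpan π U N := by
  simpa using mem_boundedSpan_of_sum (π := π) (U := U) {()} (fun _ => d) (fun _ => x)
    (N := N) (by simpa) (by simpa)

lemma boundedSpan_mono {N M : ℕ} (h : N ≤ M) : boundedSpan π U N ⊆ boundedSpan π U M := by
  rintro _ ⟨f, hf, rfl⟩
  refine mem_boundedSpan_of_sum _ id _ (fun i hi => ?_) fun i _ => hf i
  rw [Finset.mem_Icc] at hi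
  rw [id, abs_le]; omega

lemma add_mem_boundedSpan {x y : B} {N : ℕ} (hx : x ∈ boundedSpan π U N)
    (hy : y ∈ boundedSpan π U N) : x + y ∈ boundedSpan π U N := by
  obtain ⟨f, hf, rfl⟩ := hx
  obtain ⟨g, hg, rfl⟩ := hy
  exact ⟨f + g, fun d => add_mem (hf d) (hg d), by simp [Finset.sum_add_distrib]⟩

lemma star_mem_boundedSpan {x : B} {N : ℕ} (hx : x ∈ boundedSpan π U N) :
    star x ∈ boundedSpan π U N := by
  obtain ⟨f, hf, rfl⟩ := hx
  rw [star_sum]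
  refine mem_boundedSpan_of_sum _ (fun d => -d) _ (fun i hi => ?_)
    fun i _ => star_mem_degreeSpan (hf i)
  rw [Finset.mem_Icc] at hi
  rw [abs_le]; omega

namespace IsCovariantPair

lemma mul_mem_boundedSpan (h : IsCovariantPair α π U) {x y : B} {N M : ℕ}
    (hx : x ∈ boundedSpan π U N) (hy : y ∈ boundedSpan π U M) :
    x * y ∈ boundedSpan π U (N + M) := by
  obtain ⟨f, hf, rfl⟩ := hx
  obtain ⟨g, hg, rfl⟩ := hy
  rw [Finset.sum_mul_sum, ← Finset.sum_product']
  refine mem_boundedSpan_of_sum _ (fun p : ℤ × ℤ => p.1 + p.2)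
    (fun p : ℤ × ℤ => f p.1 * g p.2) (fun p hp => ?_)
    fun p _ => h.mul_mem_degreeSpan (hf p.1) (hg p.2)
  obtain ⟨h1, h2⟩ := Finset.mem_product.1 hp
  rw [Finset.mem_Icc] at h1 h2
  push_cast
  exact abs_le.2 ⟨by linarith, by linarith⟩

lemma pow_mem_boundedSpan (h : IsCovariantPair α π U) {x : B} {N : ℕ}
    (hx : x ∈ boundedSpan π U N) (m : ℕ) : x ^ m ∈ boundedSpan π U (m * N) := by
  induction m with
  | zero =>
    refine mem_boundedSpan (d := 0) (by simp) ?_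
    simpa using map_mem_degreeSpan_zero (π := π) (U := U) 1
  | succ m ih => rw [pow_succ, add_one_mul]; exact h.mul_mem_boundedSpan ih hx

lemma exists_mem_boundedSpan (h : IsCovariantPair α π U) {x : B}
    (hx : x ∈ StarAlgebra.adjoin ℂ (Set.range π ∪ {U})) : ∃ N, x ∈ boundedSpan π U N := by
  induction hx using StarAlgebra.adjoin_induction with
  | mem x hx =>
    rcases hx with ⟨a, rfl⟩ | rfl
    · exact ⟨0, mem_boundedSpan (d := 0) (by simp) (map_mem_degreeSpan_zero a)⟩
    · exact ⟨1, mem_boundedSpan (d := 1) (by simp) mem_degreeSpan_one⟩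
  | algebraMap r =>
    refine ⟨0, mem_boundedSpan (d := 0) (by simp) ?_⟩
    rw [← AlgHomClass.commutes π]
    exact map_mem_degreeSpan_zero _
  | add x y _ _ hx hy =>
    obtain ⟨N, hN⟩ := hx
    obtain ⟨M, hM⟩ := hy
    exact ⟨max N M, add_mem_boundedSpan (boundedSpan_mono (le_max_left _ _) hN)
      (boundedSpan_mono (le_max_right _ _) hM)⟩
  | mul x y _ _ hx hy =>
    obtain ⟨N, hN⟩ := hx
    obtain ⟨M, hM⟩ := hy
    exact ⟨N + M, h.mul_mem_boundedSpan hN hM⟩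
  | star x _ hx =>
    obtain ⟨N, hN⟩ := hx
    exact ⟨N, star_mem_boundedSpan hN⟩

end IsCovariantPair

/-! ### Nested form of degree-zero elements -/

/-- The words `π(a₀) + U*(π(a₁) + U*(⋯ π(aₙ) ⋯)U)U` with `n` nested factors. -/
def nestedDiag (π : A →⋆ₐ[ℂ] B) (U : B) : ℕ → Set B
  | 0 => Set.range π
  | n + 1 => {z | ∃ (a : A) (y : B), y ∈ nestedDiag π U n ∧ z = π a + star U * y * U}

lemma map_mem_nestedDiag (n : ℕ) (a : A) : π a ∈ nestedDiag π U n := by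
  induction n generalizing a with
  | zero => exact ⟨a, rfl⟩
  | succ n ih => exact ⟨a, 0, by simpa using ih 0, by simp⟩

lemma nestedDiag_mono : Monotone (nestedDiag π U) := by
  refine monotone_nat_of_le_succ fun n => ?_
  induction n with
  | zero => rintro _ ⟨a, rfl⟩; exact map_mem_nestedDiag 1 a
  | succ n ih => rintro _ ⟨a, y, hy, rfl⟩; exact ⟨a, y, ih hy, rfl⟩

lemma add_mem_nestedDiag {n : ℕ} {x y : B} (hx : x ∈ nestedDiag π U n)
    (hy : y ∈ nestedDiag π U n) : x + y ∈ nestedDiag π U n := by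
  induction n generalizing x y with
  | zero =>
    obtain ⟨a, rfl⟩ := hx
    obtain ⟨b, rfl⟩ := hy
    exact ⟨a + b, map_add _ _ _⟩
  | succ n ih =>
    obtain ⟨a, x, hx, rfl⟩ := hx
    obtain ⟨b, y, hy, rfl⟩ := hy
    exact ⟨a + b, x + y, ih hx hy, by rw [map_add]; noncomm_ring⟩

lemma smul_mem_nestedDiag {n : ℕ} {x : B} (c : ℂ) (hx : x ∈ nestedDiag π U n) :
    c • x ∈ nestedDiag π U n := by
  induction n generalizing x with
  | zero =>
    obtain ⟨a, rfl⟩ := hx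
    exact ⟨c • a, map_smul _ _ _⟩
  | succ n ih =>
    obtain ⟨a, x, hx, rfl⟩ := hx
    exact ⟨c • a, c • x, ih hx, by simp⟩

namespace IsCovariantPair

/-- Together with the right-hand version, this keeps the compression by `π(α 1)` from the norm
recursion within the same nesting depth. -/
lemma map_mul_mem_nestedDiag (h : IsCovariantPair α π U) {n : ℕ} (b : A) {x : B}
    (hx : x ∈ nestedDiag π U n) : π b * x ∈ nestedDiag π U n := by
  induction n generalizing x b with
  | zero =>
    obtain ⟨a, rfl⟩ := hx
    exact ⟨b * a, map_mul _ _ _⟩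
  | succ n ih =>
    obtain ⟨a, x, hx, rfl⟩ := hx
    refine ⟨b * a, π (α b) * x, ih _ hx, ?_⟩
    rw [mul_add, ← mul_assoc, ← mul_assoc, h.map_mul_star, map_mul, mul_assoc (star U)]

lemma mul_map_mem_nestedDiag (h : IsCovariantPair α π U) {n : ℕ} (b : A) {x : B}
    (hx : x ∈ nestedDiag π U n) : x * π b ∈ nestedDiag π U n := by
  induction n generalizing x b with
  | zero =>
    obtain ⟨a, rfl⟩ := hx
    exact ⟨a * b, map_mul _ _ _⟩
  | succ n ih =>
    obtain ⟨a, x, hx, rfl⟩ := hx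
    refine ⟨a * b, x * π (α b), ih _ hx, ?_⟩
    rw [add_mul, mul_assoc (star U * x), h.mul_map, map_mul]
    simp only [mul_assoc]

end IsCovariantPair

lemma exists_mem_nestedDiag {x : B} (hx : x ∈ degreeSpan π U 0) :
    ∃ n, x ∈ nestedDiag π U n := by
  induction hx using Submodule.span_induction with
  | mem x hx =>
    obtain ⟨m, n, a, hd, rfl⟩ := hx
    obtain rfl : n = m := by omega
    refine ⟨n, ?_⟩
    clear hd
    induction n with
    | zero => exact ⟨a, by simp⟩
    | succ n ih =>
      refine ⟨0, _, ih, ?_⟩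
      rw [pow_succ', pow_succ, map_zero, zero_add]
      simp only [mul_assoc]
  | zero => exact ⟨0, 0, map_zero _⟩
  | add x y _ _ hx hy =>
    obtain ⟨N, hN⟩ := hx
    obtain ⟨M, hM⟩ := hy
    exact ⟨max N M, add_mem_nestedDiag (nestedDiag_mono (le_max_left _ _) hN)
      (nestedDiag_mono (le_max_right _ _) hM)⟩
  | smul c x _ hx =>
    obtain ⟨N, hN⟩ := hx
    exact ⟨N, smul_mem_nestedDiag c hN⟩

end CovariantPair

/-! ### Norm estimates -/

section Norms

open scoped InnerProductSpace

variable {A B : Type*} [CStarAlgebra A] [CStarAlgebra B] {α : A →⋆ₙₐ[ℂ] A}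
  {π : A →⋆ₐ[ℂ] B} {U : B}
  {H : Type*} [NormedAddCommGroup H] [InnerProductSpace ℂ H] [CompleteSpace H]

lemma NonUnitalStarAlgHom.norm_apply_le_of_isSelfAdjoint_of_ker_le {C : Type*} [CStarAlgebra C]
    (φ : A →⋆ₙₐ[ℂ] B) (ψ : A →⋆ₙₐ[ℂ] C) (hker : ∀ a, φ a = 0 → ψ a = 0) {a : A}
    (ha : IsSelfAdjoint a) : ‖ψ a‖ ≤ ‖φ a‖ := by
  -- `f` vanishes exactly on `[-‖φ a‖, ‖φ a‖]`. Hence `φ(f(a)) = f(φ a) = 0`, so `f(ψ a) = 0`, which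
  -- confines the quasispectrum of `ψ a` to that interval.
  set f : ℝ → ℝ := fun t => max (|t| - ‖φ a‖) 0 with hf
  have hf0 : f 0 = 0 := by simp [hf]
  have hfc : Continuous f := by fun_prop
  have hφc : Continuous φ := AddMonoidHomClass.continuous_of_bound φ 1 fun x => by
    simpa using NonUnitalStarAlgHom.norm_apply_le φ x
  have hψc : Continuous ψ := AddMonoidHomClass.continuous_of_bound ψ 1 fun x => by
    simpa using NonUnitalStarAlgHom.norm_apply_le ψ x
  have hφa : IsSelfAdjoint (φ a) := ha.map φ
  have hψa : IsSelfAdjoint (ψ a) := ha.map ψ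
  have h1 : φ (cfcₙ f a) = 0 := by
    rw [NonUnitalStarAlgHom.map_cfcₙ φ f a hfc.continuousOn hf0 hφc ha hφa,
      ← cfcₙ_const_zero ℝ (φ a)]
    refine cfcₙ_congr fun t ht => max_eq_right (sub_nonpos.2 ?_)
    exact NonUnitalIsometricContinuousFunctionalCalculus.norm_quasispectrum_le (φ a) ht hφa
  have h2 := hker _ h1
  rw [NonUnitalStarAlgHom.map_cfcₙ ψ f a hfc.continuousOn hf0 hψc ha hψa,
    ← cfcₙ_const_zero ℝ (ψ a)] at h2
  have h3 := eqOn_of_cfcₙ_eq_cfcₙ h2 hψa hfc.continuousOn hf0 continuousOn_const rfl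
  rw [← cfcₙ_id ℝ (ψ a) hψa]
  exact norm_cfcₙ_le fun t ht => sub_nonpos.1 (max_eq_right_iff.1 (h3 ht))

lemma NonUnitalStarAlgHom.norm_apply_le_of_ker_le {C : Type*} [CStarAlgebra C]
    (φ : A →⋆ₙₐ[ℂ] B) (ψ : A →⋆ₙₐ[ℂ] C) (hker : ∀ a, φ a = 0 → ψ a = 0) (a : A) :
    ‖ψ a‖ ≤ ‖φ a‖ := by
  have := φ.norm_apply_le_of_isSelfAdjoint_of_ker_le ψ hker (IsSelfAdjoint.star_mul_self a)
  rw [map_mul, map_mul, map_star, map_star, CStarRing.norm_star_mul_self,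
    CStarRing.norm_star_mul_self] at this
  exact abs_le_of_sq_le_sq' (by nlinarith) (norm_nonneg _) |>.2

/-- Multiplication by `1 - U*U` turns `π` into a non-unital `*`-homomorphism. -/
def IsCovariantPair.defect (h : IsCovariantPair α π U) : A →⋆ₙₐ[ℂ] B where
  toFun a := π a * (1 - star U * U)
  map_smul' c a := by simp
  map_zero' := by simp
  map_add' a b := by simp [add_mul]
  map_mul' a b := by
    have hc : Commute (π b) (1 - star U * U) :=
      (Commute.one_right _).sub_right (h.map_commute_star_mul b)
    rw [mul_assoc (π a), ← mul_assoc _ (π b), ← hc.eq, mul_assoc (π b),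
      h.isStarProjection_star_mul.one_sub.isIdempotentElem.eq, map_mul, mul_assoc]
  map_star' a := by
    have hc : Commute (π (star a)) (1 - star U * U) :=
      (Commute.one_right _).sub_right (h.map_commute_star_mul _)
    change π (star a) * (1 - star U * U) = _
    rw [hc.eq, star_mul, map_star]
    simp

lemma IsCovariantPair.defect_apply (h : IsCovariantPair α π U) (a : A) :
    h.defect a = π a * (1 - star U * U) := rfl

lemma IsCovariantPair.defect_eq_zero_iff (h : IsCovariantPair α π U) (a : A) :
    h.defect a = 0 ↔ star U * U * π a = π a := by
  rw [h.defect_apply, mul_sub, mul_one, sub_eq_zero, (h.map_commute_star_mul a).eq, eq_comm]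

lemma IsCovariantPair.norm_le_one (h : IsCovariantPair α π U) : ‖U‖ ≤ 1 := by
  have h1 := h.isStarProjection_star_mul.norm_le
  rw [CStarRing.norm_star_mul_self] at h1
  nlinarith [norm_nonneg U]

/-- `U` is a contraction with `U U* = π(α 1)`, so each side is the other one multiplied by `U*` and
`U` on suitable sides. -/
lemma IsCovariantPair.norm_star_mul_mul (h : IsCovariantPair α π U) (y : B) :
    ‖star U * y * U‖ = ‖π (α 1) * y * π (α 1)‖ := by
  have hU := h.norm_le_one
  have hU' : ‖star U‖ ≤ 1 := by rwa [norm_star]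
  apply le_antisymm
  · calc ‖star U * y * U‖ = ‖star U * (π (α 1) * y * π (α 1)) * U‖ := by
          simp only [mul_assoc]
          rw [h.map_one_mul, ← mul_assoc (star U) (π (α 1)), h.star_mul_map_one]
      _ ≤ ‖star U‖ * ‖π (α 1) * y * π (α 1)‖ * ‖U‖ := norm_mul₃_le
      _ ≤ 1 * ‖π (α 1) * y * π (α 1)‖ * 1 := by gcongr
      _ = _ := by ring
  · calc ‖π (α 1) * y * π (α 1)‖ = ‖U * (star U * y * U) * star U‖ := by
          rw [← h.mul_star]; simp only [mul_assoc]
      _ ≤ ‖U‖ * ‖star U * y * U‖ * ‖star U‖ := norm_mul₃_le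
      _ ≤ 1 * ‖star U * y * U‖ * 1 := by gcongr
      _ = _ := by ring

/-- `x` is block diagonal for the orthogonal decomposition of `H` given by `p`; the bound follows
from Pythagoras. -/
lemma IsStarProjection.norm_eq_max_of_commute {p x : H →L[ℂ] H} (hp : IsStarProjection p)
    (hx : Commute x p) : ‖x‖ = max ‖x * (1 - p)‖ ‖x * p‖ := by
  apply le_antisymm
  · set M := max ‖x * (1 - p)‖ ‖x * p‖
    have hM : 0 ≤ M := (norm_nonneg _).trans (le_max_left _ _)
    have hpyth : ∀ u w : H, ‖p u + (1 - p) w‖ ^ 2 = ‖p u‖ ^ 2 + ‖(1 - p) w‖ ^ 2 := by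
      intro u w
      have h0 : ⟪p u, (1 - p) w⟫_ℂ = 0 := by
        rw [← ContinuousLinearMap.adjoint_inner_right, ← ContinuousLinearMap.star_eq_adjoint,
          hp.isSelfAdjoint.star_eq, ← mul_apply_eq_comp, mul_sub, mul_one,
          hp.isIdempotentElem.eq]
        simp
      rw [sq, norm_add_sq_eq_norm_sq_add_norm_sq_of_inner_eq_zero _ _ h0, sq, sq]
    refine ContinuousLinearMap.opNorm_le_bound _ hM fun v => ?_
    have e1 : x v = p (x v) + (1 - p) (x v) := by simp
    have e2 : v = p v + (1 - p) v := by simp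
    have hpx : p (x v) = (x * p) (p v) := by
      rw [← mul_apply_eq_comp, ← mul_apply_eq_comp, mul_assoc,
        hp.isIdempotentElem.eq, hx.eq]
    have hqx : (1 - p) (x v) = (x * (1 - p)) ((1 - p) v) := by
      rw [← mul_apply_eq_comp, ← mul_apply_eq_comp, mul_assoc,
        hp.one_sub.isIdempotentElem.eq, ((Commute.one_right x).sub_right hx).eq]
    have n1 : ‖p (x v)‖ ≤ M * ‖p v‖ := by
      rw [hpx]
      exact (ContinuousLinearMap.le_opNorm _ _).trans (by gcongr; exact le_max_right _ _)
    have n2 : ‖(1 - p) (x v)‖ ≤ M * ‖(1 - p) v‖ := by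
      rw [hqx]
      exact (ContinuousLinearMap.le_opNorm _ _).trans (by gcongr; exact le_max_left _ _)
    refine abs_le_of_sq_le_sq' ?_ (by positivity) |>.2
    calc ‖x v‖ ^ 2 = ‖p (x v)‖ ^ 2 + ‖(1 - p) (x v)‖ ^ 2 := by rw [← hpyth, ← e1]
      _ ≤ (M * ‖p v‖) ^ 2 + (M * ‖(1 - p) v‖) ^ 2 := by gcongr
      _ = M ^ 2 * (‖p v‖ ^ 2 + ‖(1 - p) v‖ ^ 2) := by ring
      _ = (M * ‖v‖) ^ 2 := by rw [← hpyth, ← e2]; ring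
  · refine max_le ?_ ?_
    · exact (norm_mul_le _ _).trans
        (mul_le_of_le_one_right (norm_nonneg _) hp.one_sub.norm_le)
    · exact (norm_mul_le _ _).trans (mul_le_of_le_one_right (norm_nonneg _) hp.norm_le)

lemma IsCovariantPair.norm_nested {π : A →⋆ₐ[ℂ] (H →L[ℂ] H)} {U : H →L[ℂ] H}
    (h : IsCovariantPair α π U) (a : A) (y : H →L[ℂ] H) :
    ‖π a + star U * y * U‖ = max ‖h.defect a‖ ‖π (α 1) * (π (α a) + y) * π (α 1)‖ := by
  have hP := h.isStarProjection_star_mul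
  have hUP : U * (star U * U) = U := by rw [← mul_assoc, h.mul_star, h.map_one_mul]
  have hPU : star U * U * star U = star U := by rw [mul_assoc, h.mul_star, h.star_mul_map_one]
  have hright : star U * y * U * (star U * U) = star U * y * U := by rw [mul_assoc, hUP]
  have hleft : star U * U * (star U * y * U) = star U * y * U := by
    rw [← mul_assoc, ← mul_assoc, hPU]
  have hc : Commute (π a + star U * y * U) (star U * U) :=
    (h.map_commute_star_mul a).add_left (hright.trans hleft.symm)
  rw [hP.norm_eq_max_of_commute hc, ← h.norm_star_mul_mul]
  -- On the complement of `U*U` the term `U* y U` dies; on `U*U`, `π(a) U*U = U* π(α a) U` merges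
  -- with it into `U*(π(α a) + y)U`.
  congr 2
  · rw [h.defect_apply, add_mul, mul_sub (star U * y * U), hright]
    simp
  · rw [add_mul, hright, ← mul_assoc, h.map_mul_star]
    simp only [mul_add, add_mul]

/-- Cauchy-Schwarz applied to `∑ (x i)* v`, since `∑ ‖(x i)* v‖² = ⟪v, T v⟫`. -/
lemma ContinuousLinearMap.norm_sum_sq_le {ι : Type*} (s : Finset ι) (x : ι → H →L[ℂ] H) :
    ‖∑ i ∈ s, x i‖ ^ 2 ≤ s.card * ‖∑ i ∈ s, x i * star (x i)‖ := by
  set T := ∑ i ∈ s, x i * star (x i)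
  have key : ‖∑ i ∈ s, star (x i)‖ ≤ √(s.card * ‖T‖) := by
    refine ContinuousLinearMap.opNorm_le_bound _ (Real.sqrt_nonneg _) fun v => ?_
    refine abs_le_of_sq_le_sq' ?_ (by positivity) |>.2
    rw [mul_pow, Real.sq_sqrt (by positivity), sum_apply]
    have hT : ∑ i ∈ s, ‖star (x i) v‖ ^ 2 = RCLike.re ⟪v, T v⟫_ℂ := by
      rw [sum_apply, inner_sum, map_sum]
      refine Finset.sum_congr rfl fun i _ => ?_
      rw [ContinuousLinearMap.apply_norm_sq_eq_inner_adjoint_right,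
        ← ContinuousLinearMap.star_eq_adjoint, star_star]
      rfl
    calc ‖∑ i ∈ s, star (x i) v‖ ^ 2 ≤ (∑ i ∈ s, ‖star (x i) v‖) ^ 2 := by
          gcongr; exact norm_sum_le _ _
      _ ≤ s.card * ∑ i ∈ s, ‖star (x i) v‖ ^ 2 := sq_sum_le_card_mul_sum_sq
      _ = s.card * RCLike.re ⟪v, T v⟫_ℂ := by rw [hT]
      _ ≤ s.card * (‖v‖ * (‖T‖ * ‖v‖)) := by
          gcongr
          refine (RCLike.re_le_norm _).trans ((norm_inner_le_norm _ _).trans ?_)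
          gcongr
          exact T.le_opNorm v
      _ = _ := by ring
  rw [← star_sum, norm_star] at key
  calc _ ≤ √(s.card * ‖T‖) ^ 2 := by gcongr
    _ = _ := Real.sq_sqrt (by positivity)

lemma le_of_forall_two_pow_le {p q C : ℝ} (hq : 0 ≤ q)
    (h : ∀ k : ℕ, p ^ 2 ^ k ≤ (C * 2 ^ k + 1) * q ^ 2 ^ k) : p ≤ q := by
  by_contra! hlt
  have hp0 : 0 < p := hq.trans_lt hlt
  have hr : q / p < 1 := (div_lt_one hp0).2 hlt
  have hr0 : 0 ≤ q / p := by positivity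
  have ht : Filter.Tendsto (fun n : ℕ => C * (n * (q / p) ^ n) + (q / p) ^ n) Filter.atTop
      (nhds (C * 0 + 0)) :=
    ((tendsto_self_mul_const_pow_of_lt_one hr0 hr).const_mul C).add
      (tendsto_pow_atTop_nhds_zero_of_lt_one hr0 hr)
  have ht2 := ht.comp (tendsto_pow_atTop_atTop_of_one_lt (one_lt_two (α := ℕ)))
  have h1 : (1 : ℝ) ≤ C * 0 + 0 := ge_of_tendsto' ht2 fun k => by
    have := h k
    have hpk : 0 < p ^ 2 ^ k := by positivity
    rw [← div_le_div_iff_of_pos_right hpk, div_self hpk.ne', mul_div_assoc, ← div_pow] at this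
    simp only [Function.comp_apply]
    push_cast
    linarith
  norm_num at h1

/-- `hstar` speaks of families, not of elements, because a decomposition by degree is not known to
be unique. The index `ℤ × ℤ` serves the products `f d * star (f e)`. -/
lemma IsCovariantPair.norm_sq_le_of_mem_boundedSpan {C : Type*} [CStarAlgebra C]
    (h : IsCovariantPair α π U) (φ : B →⋆ₐ[ℂ] (H →L[ℂ] H)) (ψ : B →⋆ₐ[ℂ] C)
    (hzero : ∀ z ∈ degreeSpan π U 0, ‖φ z‖ ≤ ‖ψ z‖)
    (hstar : ∀ (s : Finset (ℤ × ℤ)) (deg : ℤ × ℤ → ℤ) (g : ℤ × ℤ → B),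
      (∀ i, g i ∈ degreeSpan π U (deg i)) → ‖ψ (∑ i ∈ s with deg i = 0, g i)‖ ≤ ‖ψ (∑ i ∈ s, g i)‖)
    {N : ℕ} {x : B} (hx : x ∈ boundedSpan π U N) :
    ‖φ x‖ ^ 2 ≤ (2 * N + 1) * ‖ψ x‖ ^ 2 := by
  obtain ⟨f, hf, rfl⟩ := hx
  set s := Finset.Icc (-(N : ℤ)) N
  have hcard : (s.card : ℝ) = 2 * N + 1 := by
    have : s.card = 2 * N + 1 := by rw [Int.card_Icc]; omega
    rw [this]; push_cast; ring
  have hmem : ∑ d ∈ s, f d * star (f d) ∈ degreeSpan π U 0 := Submodule.sum_mem _ fun d _ => by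
    simpa using h.mul_mem_degreeSpan (hf d) (star_mem_degreeSpan (hf d))
  have hdiag : ∑ p ∈ s ×ˢ s with p.1 + -p.2 = 0, f p.1 * star (f p.2) =
      ∑ d ∈ s, f d * star (f d) := by
    refine Finset.sum_bij' (fun p _ => p.1) (fun d _ => (d, d)) ?_ ?_ ?_ ?_ ?_
    · intro p hp; exact (Finset.mem_product.1 (Finset.mem_filter.1 hp).1).1
    · intro d hd; simp [hd]
    · intro p hp
      have := (Finset.mem_filter.1 hp).2
      ext <;> simp; omega
    · intro d _; rfl
    · intro p hp
      have := (Finset.mem_filter.1 hp).2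
      rw [show p.2 = p.1 by omega]
  have h1 := hstar (s ×ˢ s) (fun p => p.1 + -p.2) (fun p => f p.1 * star (f p.2))
    fun p => h.mul_mem_degreeSpan (hf p.1) (star_mem_degreeSpan (hf p.2))
  rw [hdiag, Finset.sum_product' s s (fun d e => f d * star (f e)), ← Finset.sum_mul_sum,
    ← star_sum, map_mul, map_star,
    CStarRing.norm_self_mul_star] at h1
  calc ‖φ (∑ d ∈ s, f d)‖ ^ 2 ≤ s.card * ‖∑ d ∈ s, φ (f d) * star (φ (f d))‖ := by
        rw [map_sum]; exact ContinuousLinearMap.norm_sum_sq_le _ _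
    _ = s.card * ‖φ (∑ d ∈ s, f d * star (f d))‖ := by
        simp only [map_sum, map_mul, map_star]
    _ ≤ s.card * (‖ψ (∑ d ∈ s, f d)‖ * ‖ψ (∑ d ∈ s, f d)‖) := by
        gcongr; exact (hzero _ hmem).trans h1
    _ = _ := by rw [hcard]; ring

lemma IsCovariantPair.norm_le_of_mem_boundedSpan {C : Type*} [CStarAlgebra C]
    (h : IsCovariantPair α π U) (φ : B →⋆ₐ[ℂ] (H →L[ℂ] H)) (ψ : B →⋆ₐ[ℂ] C)
    (hzero : ∀ z ∈ degreeSpan π U 0, ‖φ z‖ ≤ ‖ψ z‖)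
    (hstar : ∀ (s : Finset (ℤ × ℤ)) (deg : ℤ × ℤ → ℤ) (g : ℤ × ℤ → B),
      (∀ i, g i ∈ degreeSpan π U (deg i)) → ‖ψ (∑ i ∈ s with deg i = 0, g i)‖ ≤ ‖ψ (∑ i ∈ s, g i)‖)
    {N : ℕ} {x : B} (hx : x ∈ boundedSpan π U N) : ‖φ x‖ ≤ ‖ψ x‖ := by
  have hsa : IsSelfAdjoint (x * star x) := .mul_star_self x
  have hnorm (k : ℕ) : ‖φ ((x * star x) ^ 2 ^ k)‖ ^ 2 = (‖φ x‖ ^ 4) ^ 2 ^ k := by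
    rw [map_pow, (hsa.map φ).norm_pow_two_pow, map_mul, map_star, CStarRing.norm_self_mul_star]
    ring
  refine (pow_le_pow_iff_left₀ (norm_nonneg _) (norm_nonneg _) (n := 4) (by norm_num)).1 ?_
  -- The power `(x x*)^(2^k)` has degrees bounded by `2^k * 2N`, so the factor is `4N * 2^k + 1`.
  refine le_of_forall_two_pow_le (C := 4 * N) (by positivity) fun k => ?_
  have hk := h.norm_sq_le_of_mem_boundedSpan φ ψ hzero hstar (h.pow_mem_boundedSpan
    (h.mul_mem_boundedSpan hx (star_mem_boundedSpan hx)) (2 ^ k))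
  rw [hnorm, map_pow, (hsa.map ψ).norm_pow_two_pow, map_mul, map_star,
    CStarRing.norm_self_mul_star] at hk
  refine hk.trans_eq ?_
  push_cast
  ring

end Norms

/-! ### Comparing two representations -/

section Isomorphism

variable {A : Type*} [CStarAlgebra A] {α : A →⋆ₙₐ[ℂ] A}

lemma degreeSpan_map {B C : Type*} [CStarAlgebra B] [CStarAlgebra C] {π : A →⋆ₐ[ℂ] B} {U : B}
    {π' : A →⋆ₐ[ℂ] C} {U' : C} (φ : B →⋆ₐ[ℂ] C) (hπ : ∀ a, φ (π a) = π' a) (hU : φ U = U')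
    {d : ℤ} {x : B} (hx : x ∈ degreeSpan π U d) : φ x ∈ degreeSpan π' U' d := by
  induction hx using Submodule.span_induction with
  | mem x hx =>
    obtain ⟨m, n, a, hd, rfl⟩ := hx
    rw [map_mul, map_mul, map_pow, map_pow, map_star, hπ, hU]
    exact word_mem_degreeSpan m n a hd
  | zero => simp
  | add x y _ _ hx hy => simpa using add_mem hx hy
  | smul c x _ hx => simpa using Submodule.smul_mem _ c hx

namespace DynRep

variable {H : Type*} [NormedAddCommGroup H] [InnerProductSpace ℂ H] [CompleteSpace H]

lemma isCovariantPair (R : DynRep α H) : IsCovariantPair α R.π R.U := R.covariance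

lemma IsAdmissible.add {a b : ℕ × ℕ →₀ A} (ha : IsAdmissible α a) (hb : IsAdmissible α b) :
    IsAdmissible α (a + b) := fun i j => by
  obtain ⟨x, hx⟩ := ha i j
  obtain ⟨y, hy⟩ := hb i j
  exact ⟨x + y, by rw [Finsupp.add_apply, hx, hy, mul_add, add_mul]⟩

lemma IsAdmissible.zero : IsAdmissible α 0 := fun _ _ => ⟨0, by simp⟩

lemma IsAdmissible.smul {a : ℕ × ℕ →₀ A} (c : ℂ) (ha : IsAdmissible α a) :
    IsAdmissible α (c • a) := fun i j => by
  obtain ⟨x, hx⟩ := ha i j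
  exact ⟨c • x, by rw [Finsupp.smul_apply, hx]; simp⟩

lemma IsAdmissible.sum {ι : Type*} (s : Finset ι) {a : ι → ℕ × ℕ →₀ A}
    (ha : ∀ i ∈ s, IsAdmissible α (a i)) : IsAdmissible α (∑ i ∈ s, a i) :=
  Finset.sum_induction a _ (fun _ _ => .add) .zero ha

/-- `DynRep.ofMatrix` as a linear map. -/
noncomputable def ofMatrixₗ (R : DynRep α H) : (ℕ × ℕ →₀ A) →ₗ[ℂ] (H →L[ℂ] H) :=
  Finsupp.lsum ℂ fun p => LinearMap.mulRight ℂ (R.U ^ p.2) ∘ₗ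
    LinearMap.mulLeft ℂ (star R.U ^ p.1) ∘ₗ (R.π : A →ₗ[ℂ] (H →L[ℂ] H))

lemma ofMatrixₗ_apply (R : DynRep α H) (a : ℕ × ℕ →₀ A) : R.ofMatrixₗ a = R.ofMatrix a := rfl

lemma exists_matrix (R : DynRep α H) {d : ℤ} {x : H →L[ℂ] H} (hx : x ∈ degreeSpan R.π R.U d) :
    ∃ a : ℕ × ℕ →₀ A, IsAdmissible α a ∧ (∀ p, a p ≠ 0 → (p.2 : ℤ) - p.1 = d) ∧
      R.ofMatrixₗ a = x := by
  induction hx using Submodule.span_induction with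
  | mem x hx =>
    obtain ⟨m, n, a, hd, rfl⟩ := hx
    -- Padding by `α^[m] 1` and `α^[n] 1` makes the entry admissible; `U*ᵐ` and `Uⁿ` absorb it.
    refine ⟨Finsupp.single (m, n) (α^[m] 1 * a * α^[n] 1), fun i j => ?_, fun p hp => ?_, ?_⟩
    · by_cases hij : (m, n) = (i, j)
      · obtain ⟨rfl, rfl⟩ := Prod.mk.inj hij
        exact ⟨a, Finsupp.single_eq_same⟩
      · exact ⟨0, by rw [Finsupp.single_eq_of_ne' hij]; simp⟩
    · obtain rfl : p = (m, n) := by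
        by_contra hne
        exact hp (Finsupp.single_eq_of_ne hne)
      exact hd
    · have h := R.isCovariantPair
      rw [ofMatrixₗ_apply, ofMatrix, Finsupp.sum_single_index (by simp), map_mul, map_mul]
      simp only [mul_assoc]
      rw [h.map_iterate_one_mul_pow, ← mul_assoc, h.star_pow_mul_map_iterate_one]
  | zero => exact ⟨0, .zero, by simp, map_zero _⟩
  | add x y _ _ hx hy =>
    obtain ⟨a, ha, hda, rfl⟩ := hx
    obtain ⟨b, hb, hdb, rfl⟩ := hy
    refine ⟨a + b, ha.add hb, fun p hp => ?_, map_add _ _ _⟩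
    by_cases hap : a p = 0
    · exact hdb p fun hbp => hp (by simp [hap, hbp])
    · exact hda p hap
  | smul c x _ hx =>
    obtain ⟨a, ha, hda, rfl⟩ := hx
    exact ⟨c • a, ha.smul c, fun p hp => hda p fun h0 => hp (by simp [h0]), map_smul _ _ _⟩

lemma PropertyStar.norm_sum_filter_le {R : DynRep α H} (hR : R.PropertyStar) {ι : Type*}
    (s : Finset ι) (deg : ι → ℤ) (g : ι → H →L[ℂ] H)
    (hg : ∀ i, g i ∈ degreeSpan R.π R.U (deg i)) :
    ‖∑ i ∈ s with deg i = 0, g i‖ ≤ ‖∑ i ∈ s, g i‖ := by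
  choose a ha hdeg hag using fun i => R.exists_matrix (hg i)
  have hfilter (i : ι) :
      (a i).filter (fun p => p.1 = p.2) = if deg i = 0 then a i else 0 := by
    split_ifs with hi
    · refine Finsupp.filter_eq_self_iff _ _ |>.2 fun p hp => ?_
      have := hdeg i p hp
      omega
    · refine Finsupp.filter_eq_zero_iff _ _ |>.2 fun p hp => ?_
      by_contra hne
      have := hdeg i p hne
      omega
  have h := hR (∑ i ∈ s, a i) (.sum s fun i _ => ha i)
  rw [Finsupp.filter_sum, Finset.sum_congr rfl fun i _ => hfilter i, ← Finset.sum_filter,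
    ← ofMatrixₗ_apply, ← ofMatrixₗ_apply, map_sum, map_sum] at h
  simpa only [hag] using h

variable {H₁ : Type*} [NormedAddCommGroup H₁] [InnerProductSpace ℂ H₁] [CompleteSpace H₁]
  {H₂ : Type*} [NormedAddCommGroup H₂] [InnerProductSpace ℂ H₂] [CompleteSpace H₂]

lemma isCovariantPair_prod (R₁ : DynRep α H₁) (R₂ : DynRep α H₂) :
    IsCovariantPair α (R₁.π.prod R₂.π) (R₁.U, R₂.U) := fun a =>
  Prod.ext (R₁.covariance a) (R₂.covariance a)

lemma norm_map_eq_of_isFaithful {R₁ : DynRep α H₁} {R₂ : DynRep α H₂}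
    (hf₁ : R₁.IsFaithful) (hf₂ : R₂.IsFaithful) (a : A) : ‖R₁.π a‖ = ‖R₂.π a‖ := by
  rw [NonUnitalStarAlgHom.norm_map R₁.π hf₁, NonUnitalStarAlgHom.norm_map R₂.π hf₂]

/-- The kernel of each defect map is `J`, and inclusion of kernels gives an inequality of norms. -/
lemma norm_defect_le {J : TwoSidedIdeal A} {R₁ : DynRep α H₁} {R₂ : DynRep α H₂}
    (hc₁ : R₁.IsCovariantFor J) (hc₂ : R₂.IsCovariantFor J) (a : A) :
    ‖R₁.isCovariantPair.defect a‖ ≤ ‖R₂.isCovariantPair.defect a‖ := by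
  refine NonUnitalStarAlgHom.norm_apply_le_of_ker_le _ _ (fun a ha => ?_) a
  rw [IsCovariantPair.defect_eq_zero_iff] at ha ⊢
  have h : a ∈ {a : A | star R₂.U * R₂.U * R₂.π a = R₂.π a} := ha
  rw [← hc₂, hc₁] at h
  exact h

lemma norm_fst_eq_norm_snd_of_mem_nestedDiag {J : TwoSidedIdeal A}
    {R₁ : DynRep α H₁} {R₂ : DynRep α H₂} (hf₁ : R₁.IsFaithful) (hf₂ : R₂.IsFaithful)
    (hc₁ : R₁.IsCovariantFor J) (hc₂ : R₂.IsCovariantFor J) {n : ℕ}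
    {z : (H₁ →L[ℂ] H₁) × (H₂ →L[ℂ] H₂)}
    (hz : z ∈ nestedDiag (R₁.π.prod R₂.π) (R₁.U, R₂.U) n) : ‖z.1‖ = ‖z.2‖ := by
  induction n generalizing z with
  | zero =>
    obtain ⟨a, rfl⟩ := hz
    exact norm_map_eq_of_isFaithful hf₁ hf₂ a
  | succ n ih =>
    obtain ⟨a, y, hy, rfl⟩ := hz
    have h := isCovariantPair_prod R₁ R₂
    have hmem := h.mul_map_mem_nestedDiag (α 1) (h.map_mul_mem_nestedDiag (α 1)
      (add_mem_nestedDiag (map_mem_nestedDiag n (α a)) hy))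
    change ‖R₁.π a + star R₁.U * y.1 * R₁.U‖ = ‖R₂.π a + star R₂.U * y.2 * R₂.U‖
    rw [R₁.isCovariantPair.norm_nested, R₂.isCovariantPair.norm_nested,
      le_antisymm (norm_defect_le hc₁ hc₂ a) (norm_defect_le hc₂ hc₁ a)]
    have e := ih hmem
    simp only [Prod.fst_mul, Prod.snd_mul, Prod.fst_add, Prod.snd_add, StarAlgHom.prod_apply] at e
    rw [e]

lemma norm_fst_eq_norm_snd_of_mem_adjoin {J : TwoSidedIdeal A}
    {R₁ : DynRep α H₁} {R₂ : DynRep α H₂} (hf₁ : R₁.IsFaithful) (hf₂ : R₂.IsFaithful)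
    (hc₁ : R₁.IsCovariantFor J) (hc₂ : R₂.IsCovariantFor J)
    (hs₁ : R₁.PropertyStar) (hs₂ : R₂.PropertyStar)
    {z : (H₁ →L[ℂ] H₁) × (H₂ →L[ℂ] H₂)}
    (hz : z ∈ StarAlgebra.adjoin ℂ (Set.range (R₁.π.prod R₂.π) ∪ {(R₁.U, R₂.U)})) :
    ‖z.1‖ = ‖z.2‖ := by
  have h := isCovariantPair_prod R₁ R₂
  obtain ⟨N, hN⟩ := h.exists_mem_boundedSpan hz
  have hzero : ∀ z ∈ degreeSpan (R₁.π.prod R₂.π) (R₁.U, R₂.U) 0, ‖z.1‖ = ‖z.2‖ :=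
    fun z hz => (exists_mem_nestedDiag hz).elim fun _ hn =>
      norm_fst_eq_norm_snd_of_mem_nestedDiag hf₁ hf₂ hc₁ hc₂ hn
  let p₁ := StarAlgHom.fst ℂ (H₁ →L[ℂ] H₁) (H₂ →L[ℂ] H₂)
  let p₂ := StarAlgHom.snd ℂ (H₁ →L[ℂ] H₁) (H₂ →L[ℂ] H₂)
  have hπ₁ : ∀ a, p₁ (R₁.π.prod R₂.π a) = R₁.π a := fun _ => rfl
  have hπ₂ : ∀ a, p₂ (R₁.π.prod R₂.π a) = R₂.π a := fun _ => rfl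
  have hU₁ : p₁ (R₁.U, R₂.U) = R₁.U := rfl
  have hU₂ : p₂ (R₁.U, R₂.U) = R₂.U := rfl
  apply le_antisymm
  · refine h.norm_le_of_mem_boundedSpan p₁ p₂ (fun z hz => (hzero z hz).le)
      (fun s deg g hg => ?_) hN
    have hmem (i : ℤ × ℤ) : p₂ (g i) ∈ degreeSpan R₂.π R₂.U (deg i) :=
      degreeSpan_map p₂ hπ₂ hU₂ (hg i)
    have hle := hs₂.norm_sum_filter_le s deg _ hmem
    rwa [← map_sum, ← map_sum] at hle
  · refine h.norm_le_of_mem_boundedSpan p₂ p₁ (fun z hz => (hzero z hz).ge)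
      (fun s deg g hg => ?_) hN
    have hmem (i : ℤ × ℤ) : p₁ (g i) ∈ degreeSpan R₁.π R₁.U (deg i) :=
      degreeSpan_map p₁ hπ₁ hU₁ (hg i)
    have hle := hs₁.norm_sum_filter_le s deg _ hmem
    rwa [← map_sum, ← map_sum] at hle

end DynRep

/-! ### Closures and uniqueness -/

/-- A `*`-homomorphism that is isometric on the `*`-algebra generated by `s` restricts to a
bijection between the generated `C*`-algebras. -/
lemma exists_starAlgEquiv_topologicalClosure_adjoin {B C : Type*} [CStarAlgebra B]
    [CStarAlgebra C] (φ : B →⋆ₐ[ℂ] C) (s : Set B)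
    (hφ : ∀ x ∈ StarAlgebra.adjoin ℂ s, ‖φ x‖ = ‖x‖) :
    ∃ e : (StarAlgebra.adjoin ℂ s).topologicalClosure ≃⋆ₐ[ℂ]
        (StarAlgebra.adjoin ℂ (φ '' s)).topologicalClosure, ∀ x, (e x : C) = φ x := by
  set S := StarAlgebra.adjoin ℂ s
  have hc : Continuous φ := AddMonoidHomClass.continuous_of_bound φ 1 fun x => by
    simpa using NonUnitalStarAlgHom.norm_apply_le φ x
  have hnorm : ∀ x ∈ S.topologicalClosure, ‖φ x‖ = ‖x‖ := fun x hx =>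
    closure_minimal hφ (isClosed_eq hc.norm continuous_norm) hx
  have hmap : S.map φ = StarAlgebra.adjoin ℂ (φ '' s) := StarAlgHom.map_adjoin φ s
  have hmem (x : S.topologicalClosure) :
      φ x ∈ (StarAlgebra.adjoin ℂ (φ '' s)).topologicalClosure := by
    rw [← hmap]
    exact map_mem_closure hc x.2 fun y hy => ⟨y, hy, rfl⟩
  let ψ : S.topologicalClosure →⋆ₐ[ℂ] (StarAlgebra.adjoin ℂ (φ '' s)).topologicalClosure :=
    (φ.comp S.topologicalClosure.subtype).codRestrict _ hmem
  have hiso : Isometry ψ := AddMonoidHomClass.isometry_of_norm ψ fun x => hnorm x x.2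
  have hsurj : Function.Surjective ψ := by
    have hcl : IsClosed (Set.range fun x : S.topologicalClosure => φ x) := by
      have : Isometry fun x : S.topologicalClosure => φ x := fun x y => hiso x y
      have : CompleteSpace S.topologicalClosure :=
        (StarSubalgebra.isClosed_topologicalClosure S).completeSpace_coe
      exact Isometry.isClosedEmbedding (by assumption) |>.isClosed_range
    intro ⟨y, hy⟩
    obtain ⟨x, hx⟩ : y ∈ Set.range fun x : S.topologicalClosure => φ x := by
      refine closure_minimal ?_ hcl hy
      rw [← hmap]
      rintro _ ⟨x, hx, rfl⟩
      exact ⟨⟨x, S.le_topologicalClosure hx⟩, rfl⟩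
    exact ⟨x, Subtype.ext hx⟩
  exact ⟨StarAlgEquiv.ofBijective ψ ⟨hiso.injective, hsurj⟩, fun x => rfl⟩

namespace DynRep

variable {H₁ : Type*} [NormedAddCommGroup H₁] [InnerProductSpace ℂ H₁] [CompleteSpace H₁]
  {H₂ : Type*} [NormedAddCommGroup H₂] [InnerProductSpace ℂ H₂] [CompleteSpace H₂]

lemma starAlgEquiv_cstar_ext {R₁ : DynRep α H₁} {R₂ : DynRep α H₂}
    {Φ Ψ : R₁.cstar ≃⋆ₐ[ℂ] R₂.cstar} (hgen : ∀ a, Φ (R₁.gen a) = Ψ (R₁.gen a))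
    (hU : Φ R₁.genU = Ψ R₁.genU) : Φ = Ψ := by
  have h₁ : IsClosed (R₁.cstar : Set (H₁ →L[ℂ] H₁)) :=
    StarSubalgebra.isClosed_topologicalClosure _
  have h₂ : IsClosed (R₂.cstar : Set (H₂ →L[ℂ] H₂)) :=
    StarSubalgebra.isClosed_topologicalClosure _
  have hc (Θ : R₁.cstar ≃⋆ₐ[ℂ] R₂.cstar) : Continuous Θ :=
    AddMonoidHomClass.continuous_of_bound Θ 1 fun x => by
      simpa using NonUnitalStarAlgHom.norm_apply_le Θ x
  have key : (Φ : R₁.cstar →⋆ₐ[ℂ] R₂.cstar) = Ψ := by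
    refine StarAlgHom.ext_topologicalClosure (hc Φ) (hc Ψ) (StarAlgHom.ext_adjoin ?_)
    rintro x (⟨a, hx⟩ | hx)
    · rw [show x = ⟨R₁.π a, StarAlgebra.subset_adjoin ℂ _ (Or.inl ⟨a, rfl⟩)⟩ from
        Subtype.ext hx.symm]
      exact hgen a
    · rw [show x = ⟨R₁.U, StarAlgebra.subset_adjoin ℂ _ (Or.inr rfl)⟩ from Subtype.ext hx]
      exact hU
  exact StarAlgEquiv.ext fun x => DFunLike.congr_fun key x

end DynRep

end Isomorphism

theorem mainTheorem8 {A : Type*} [CStarAlgebra A] (α : A →⋆ₙₐ[ℂ] A)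
    (J : TwoSidedIdeal A) (hJclosed : IsClosed (J : Set A))
    (hJ : J ⊓ TwoSidedIdeal.ker α = ⊥)
    {H₁ : Type*} [NormedAddCommGroup H₁] [InnerProductSpace ℂ H₁] [CompleteSpace H₁]
    {H₂ : Type*} [NormedAddCommGroup H₂] [InnerProductSpace ℂ H₂] [CompleteSpace H₂]
    (R₁ : DynRep α H₁) (R₂ : DynRep α H₂)
    (hf₁ : R₁.IsFaithful) (hf₂ : R₂.IsFaithful)
    (hc₁ : R₁.IsCovariantFor J) (hc₂ : R₂.IsCovariantFor J)
    (hs₁ : R₁.PropertyStar) (hs₂ : R₂.PropertyStar) :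
    ∃! Φ : R₁.cstar ≃⋆ₐ[ℂ] R₂.cstar,
      (∀ a : A, Φ (R₁.gen a) = R₂.gen a) ∧ Φ R₁.genU = R₂.genU := by
  refine existsUnique_of_exists_of_unique ?_ fun Φ Ψ hΦ hΨ =>
    DynRep.starAlgEquiv_cstar_ext (fun a => by rw [hΦ.1, hΨ.1]) (by rw [hΦ.2, hΨ.2])
  set s := Set.range (R₁.π.prod R₂.π) ∪ {(R₁.U, R₂.U)} with hs
  have hnorm : ∀ z ∈ StarAlgebra.adjoin ℂ s, ‖z.1‖ = ‖z.2‖ := fun z hz =>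
    DynRep.norm_fst_eq_norm_snd_of_mem_adjoin hf₁ hf₂ hc₁ hc₂ hs₁ hs₂ hz
  have himage₁ : StarAlgHom.fst ℂ (H₁ →L[ℂ] H₁) (H₂ →L[ℂ] H₂) '' s =
      Set.range R₁.π ∪ {R₁.U} := by
    rw [hs, Set.image_union, Set.image_singleton, ← Set.range_comp]; rfl
  have himage₂ : StarAlgHom.snd ℂ (H₁ →L[ℂ] H₁) (H₂ →L[ℂ] H₂) '' s =
      Set.range R₂.π ∪ {R₂.U} := by
    rw [hs, Set.image_union, Set.image_singleton, ← Set.range_comp]; rfl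
  have hex₁ := exists_starAlgEquiv_topologicalClosure_adjoin
    (StarAlgHom.fst ℂ (H₁ →L[ℂ] H₁) (H₂ →L[ℂ] H₂)) s fun z hz => by
      -- The product carries the max norm, so equal coordinate norms make each projection isometric.
      rw [Prod.norm_def, ← hnorm z hz, max_self]; rfl
  have hex₂ := exists_starAlgEquiv_topologicalClosure_adjoin
    (StarAlgHom.snd ℂ (H₁ →L[ℂ] H₁) (H₂ →L[ℂ] H₂)) s fun z hz => by
      rw [Prod.norm_def, hnorm z hz, max_self]; rfl
  rw [himage₁] at hex₁
  rw [himage₂] at hex₂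
  obtain ⟨e₁, he₁⟩ := hex₁
  obtain ⟨e₂, he₂⟩ := hex₂
  have hcomp (z : (StarAlgebra.adjoin ℂ s).topologicalClosure) :
      (e₁.symm.trans e₂) (e₁ z) = e₂ z :=
    congrArg e₂ (e₁.symm_apply_apply z)
  refine ⟨e₁.symm.trans e₂, fun a => ?_, ?_⟩
  · let z : (StarAlgebra.adjoin ℂ s).topologicalClosure :=
      ⟨R₁.π.prod R₂.π a, StarSubalgebra.le_topologicalClosure _
        (StarAlgebra.subset_adjoin ℂ _ (Or.inl ⟨a, rfl⟩))⟩
    have h1 : e₁ z = R₁.gen a := Subtype.ext (he₁ z)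
    have h2 : e₂ z = R₂.gen a := Subtype.ext (he₂ z)
    rw [← h1, ← h2]
    exact hcomp z
  · let z : (StarAlgebra.adjoin ℂ s).topologicalClosure :=
      ⟨(R₁.U, R₂.U), StarSubalgebra.le_topologicalClosure _
        (StarAlgebra.subset_adjoin ℂ _ (Or.inr rfl))⟩
    have h1 : e₁ z = R₁.genU := Subtype.ext (he₁ z)
    have h2 : e₂ z = R₂.genU := Subtype.ext (he₂ z)
    rw [← h1, ← h2]
    exact hcomp z
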